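/- **Setting.** There are $K$ arms. Let $\mathcal D$ be a set of probability distributions on $\mathbb R$ with finite expectation. A bandit instance $\underline\nu=(\nu_a)_{a\in[K]}\in\mathcal D$ consists of a reward distribution $\nu_a\in\mathcal D$ of expectation $\mu_a$ for each arm $a\in[K]=\{1,\dots,K\}$. Put $\mu^*=\max_{a}\mu_a$ and let $\mathcal A_*(\underline\nu)=\{a:\mu_a=\mu^*\}$ be the set of optimal arms. Let $(U_t)_{t\ge 0}$ be i.i.d. uniform on $[0,1]$ (internal randomization). A bandit strategy is a sequence of measurable maps that send the history $I_t=(U_0,a_1,q_1,R_1q_1,U_1,\dots,a_t,q_t,R_tq_t,U_t)$ to the next arm $a_{t+1}\in[K]$ and the next query decision $q_{t+1}\in\{0,1\}$; given these, a reward $R_{t+1}\sim\nu_{a_{t+1}}$ is drawn independently of the past, and only $R_{t+1}q_{t+1}$ is observed. $\mathbb E_{\underline\nu}$ denotes the expectation under this interaction. Let $$N_T(a)=\sum_{s=1}^T\mathbf 1\{a_s=a\},\qquad N^q_T(a)=\sum_{s=1}^T\mathbf 1\{a_s=a,\ q_s=1\}.$$ Define $$\mathcal K_{\inf}^+(\nu,\mu,\mathcal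 D)=\inf\{\mathrm{KL}(\nu,\nu'):\nu'\in\mathcal D,\ \mathbb E[\nu']>\mu\}\in[0,\infty],$$ with $\inf\emptyset=+\infty$. A strategy is *better-than-uniform* on $\mathcal D$ if for every instance $\underline\nu\in\mathcal D$ and every $T\ge1$, $$\sum_{a\in\mathcal A_*(\underline\nu)}\mathbb E_{\underline\nu}[N_T(a)]\ \ge\ \frac{|\mathcal A_*(\underline\nu)|}{K}\,T.$$ **Proposition.** For every strategy that is better-than-uniform on $\mathcal D$, every bandit instance $\underline\nu\in\mathcal D$, every suboptimal arm $a\notin\mathcal A_*(\underline\nu)$ and every $T\ge1$, $$\mathbb E_{\underline\nu}[N_T(a)]\ \ge\ \frac TK\left(1-\sqrt{2\min\{K\,\mathbb E_{\underline\nu}[N^q_T(a)],\,T\}\;\mathcal K_{\inf}^+(\nu_a,\mu^*,\mathcal D)}\right),$$ where the right-hand side is defined to be $0$ if $\mathcal K_{\inf}^+(\nu_a,\mu^*,\mathcal D)=\infty$. In particular, if $\mathcal K_{\inf}^+(\nu_a,\mu^*,\mathcal D)<\infty$ and $\mathbb E_{\underline\nu}[N^q_T(a)]\le \frac{1}{8K\,\mathcal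 K_{\inf}^+(\nu_a,\mu^*,\mathcal D)}$ (with $1/0=+\infty$), then $\mathbb E_{\underline\nu}[N_T(a)]\ge \frac{T}{2K}$. -/

import Mathlib

open MeasureTheory ProbabilityTheory InformationTheory Finset
open scoped ENNReal unitInterval

noncomputable section

namespace QueryBandit

/-- What is appended to the history in one round: the played arm `a_t` and the query decision `q_t`,
the observation `R_t * q_t`, and the fresh internal randomization `U_t`. -/
abbrev Round (K : ℕ) : Type := ((Fin K × Bool) × ℝ) × I

/-- The `t`-th entry of an interaction: `U_0` for `t = 0`, and the record of round `t` for
`t ≥ 1`. -/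
def Entry (K : ℕ) : ℕ → Type
  | 0 => I
  | _ + 1 => Round K

instance instMeasurableSpaceEntry (K : ℕ) : (t : ℕ) → MeasurableSpace (Entry K t)
  | 0 => inferInstanceAs (MeasurableSpace I)
  | _ + 1 => inferInstanceAs (MeasurableSpace (Round K))

/-- The history `I_t = (U_0, a_1, q_1, R_1 q_1, U_1, …, a_t, q_t, R_t q_t, U_t)`. -/
abbrev History (K t : ℕ) : Type := (i : Finset.Iic t) → Entry K i

/-- A whole interaction `(U_0, a_1, q_1, R_1 q_1, U_1, a_2, …)`. -/
abbrev Interaction (K : ℕ) : Type := (t : ℕ) → Entry K t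

/-- A bandit strategy: it maps (measurably) the history `I_t` to the next arm `a_{t+1}` and the next
query decision `q_{t+1}`. -/
structure Strategy (K : ℕ) where
  next : (t : ℕ) → History K t → Fin K × Bool
  measurable_next : ∀ t, Measurable (next t)

/-- A bandit instance: a reward distribution for each arm. -/
abbrev Instance (K : ℕ) : Type := Fin K → ProbabilityMeasure ℝ

/-- The expectation of a reward distribution. -/
def mean (ν : ProbabilityMeasure ℝ) : ℝ := ∫ x, x ∂(ν : Measure ℝ)

/-- The optimal reward `μ*` of an instance. -/
def optReward {K : ℕ} (ν : Instance K) : ℝ := ⨆ a, mean (ν a)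

/-- The set of optimal arms of an instance. -/
def optArms {K : ℕ} (ν : Instance K) : Finset (Fin K) := {a | mean (ν a) = optReward ν}

/-- The law of the observation `R * q`, where the reward `R` has law `ν_a`. -/
def obsLaw {K : ℕ} (ν : Instance K) (aq : Fin K × Bool) : Measure ℝ :=
  (ν aq.1 : Measure ℝ).map (fun r => if aq.2 then r else 0)

instance instIsProbabilityMeasureObsLaw {K : ℕ} (ν : Instance K) (aq : Fin K × Bool) :
    IsProbabilityMeasure (obsLaw ν aq) := by
  unfold obsLaw
  refine Measure.isProbabilityMeasure_map (Measurable.aemeasurable ?_)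
  cases aq.2 <;> (simp; try fun_prop)

/-- The law of the record of a round, given the arm and the query decision taken in it: the
observation and the fresh uniform variable are independent. -/
def roundKernel {K : ℕ} (ν : Instance K) : Kernel (Fin K × Bool) (Round K) where
  toFun aq := ((Measure.dirac aq).prod (obsLaw ν aq)).prod (volume : Measure I)
  measurable' := measurable_of_countable _

instance instIsMarkovKernelRoundKernel {K : ℕ} (ν : Instance K) :
    IsMarkovKernel (roundKernel ν) where
  isProbabilityMeasure aq :=
    inferInstanceAs
      (IsProbabilityMeasure (((Measure.dirac aq).prod (obsLaw ν aq)).prod (volume : Measure I)))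

/-- The conditional law of the record of round `t + 1` given the history `I_t`. -/
def stepKernel {K : ℕ} (π : Strategy K) (ν : Instance K) (t : ℕ) :
    Kernel (History K t) (Entry K (t + 1)) :=
  (roundKernel ν).comap (π.next t) (π.measurable_next t)

instance instIsMarkovKernelStepKernel {K : ℕ} (π : Strategy K) (ν : Instance K) (t : ℕ) :
    IsMarkovKernel (stepKernel π ν t) :=
  inferInstanceAs (IsMarkovKernel ((roundKernel ν).comap (π.next t) (π.measurable_next t)))

/-- The law of `U_0`. -/
def seedLaw (K : ℕ) : Measure (Entry K 0) := (volume : Measure I)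

instance instIsProbabilityMeasureSeedLaw (K : ℕ) : IsProbabilityMeasure (seedLaw K) :=
  inferInstanceAs (IsProbabilityMeasure (volume : Measure I))

/-- The law of the interaction of the strategy `π` with the instance `ν`. -/
def law {K : ℕ} (π : Strategy K) (ν : Instance K) : Measure (Interaction K) :=
  Kernel.trajMeasure (seedLaw K) (stepKernel π ν)

/-- The arm `a_{s+1}` played in round `s + 1`. -/
def arm {K : ℕ} (s : ℕ) (ω : Interaction K) : Fin K :=
  let r : Round K := ω (s + 1)
  r.1.1.1

/-- The query decision `q_{s+1}` taken in round `s + 1`. -/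
def query {K : ℕ} (s : ℕ) (ω : Interaction K) : Bool :=
  let r : Round K := ω (s + 1)
  r.1.1.2

/-- The number of plays of arm `a` in rounds `1, …, T`. -/
def plays {K : ℕ} (T : ℕ) (a : Fin K) (ω : Interaction K) : ℝ :=
  ∑ s ∈ range T, if arm s ω = a then 1 else 0

/-- The number of queries of arm `a` in rounds `1, …, T`. -/
def queries {K : ℕ} (T : ℕ) (a : Fin K) (ω : Interaction K) : ℝ :=
  ∑ s ∈ range T, if arm s ω = a ∧ query s ω = true then 1 else 0

/-- The expected number of plays of arm `a` in rounds `1, …, T`. -/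
def expPlays {K : ℕ} (π : Strategy K) (ν : Instance K) (T : ℕ) (a : Fin K) : ℝ :=
  ∫ ω, plays T a ω ∂(law π ν)

/-- The expected number of queries of arm `a` in rounds `1, …, T`. -/
def expQueries {K : ℕ} (π : Strategy K) (ν : Instance K) (T : ℕ) (a : Fin K) : ℝ :=
  ∫ ω, queries T a ω ∂(law π ν)

/-- A strategy is better than uniform on `D` if on every instance with reward distributions in `D`,
the optimal arms are together played at least as often, in expectation, as under uniform play. -/
def BetterThanUniform {K : ℕ} (π : Strategy K) (D : Set (ProbabilityMeasure ℝ)) : Prop :=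
  ∀ ν : Instance K, (∀ k, ν k ∈ D) → ∀ T : ℕ, 1 ≤ T →
    ((optArms ν).card : ℝ) / K * T ≤ ∑ a ∈ optArms ν, expPlays π ν T a

/-- The infimum of `KL(ν, ν')` over `ν' ∈ D` with expectation larger than `μ`
(`∞` if there are none). -/
def KinfPlus (ν : ProbabilityMeasure ℝ) (μ : ℝ) (D : Set (ProbabilityMeasure ℝ)) : ℝ≥0∞ :=
  ⨅ ν' ∈ {ν' | ν' ∈ D ∧ μ < mean ν'}, klDiv (ν : Measure ℝ) (ν' : Measure ℝ)

end QueryBandit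

end

/-!
Replacing the reward law of `a` alone by some `ρ ∈ D` with `mean ρ > μ*` makes `a` the only optimal
arm, so on the modified instance it is played at least `T / K` times in expectation. The
observations of the two instances differ only when `a` is queried, so the laws of their histories
are at divergence exactly `klDiv (ν a) ρ * E[N^q_T(a)]`. These two facts are combined by a local
form of Pinsker's inequality: for a `[0, M]`-valued `Z` with `∫ Z dP ≤ q ≤ ∫ Z dQ`, the factor
`M ^ 2 / 2` of the usual inequality is replaced by `2 * q * M`, because the exponential moment of
`-l * Z` under `Q` is controlled through `Z ^ 2 ≤ M * Z`. With `Z = N_T(a)`, `M = T`, `q = T / K`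
and the infimum over `ρ`, this is the bound with `K * E[N^q_T(a)]`. The minimum with `T` costs
nothing: either `E[N_T(a)] ≥ T / K`, or `K * E[N^q_T(a)] ≤ K * E[N_T(a)] ≤ T`.
-/

namespace QueryBandit

open scoped Topology

/-! ### Kullback-Leibler divergence -/

section KL

variable {α β : Type*} {mα : MeasurableSpace α} {mβ : MeasurableSpace β}

lemma mul_le_klFun_add_exp_sub_one {r : ℝ} (hr : 0 ≤ r) (y : ℝ) :
    r * y ≤ klFun r + (Real.exp y - 1) := by
  rcases hr.eq_or_lt with rfl | hr
  · simp [klFun_zero, (Real.exp_pos y).le]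
  · have h_log := mul_le_mul_of_nonneg_left
      (Real.log_le_sub_one_of_pos (div_pos (Real.exp_pos y) hr)) hr.le
    rw [Real.log_div (Real.exp_pos y).ne' hr.ne', Real.log_exp] at h_log
    have h_cancel : r * (Real.exp y / r - 1) = Real.exp y - r := by field_simp
    rw [klFun_apply]
    linarith

lemma integral_le_toReal_klDiv_add_integral_exp_sub_one {P Q : Measure α} [IsFiniteMeasure P]
    [IsFiniteMeasure Q] (hPQ : klDiv P Q ≠ ∞) {f : α → ℝ} (hfP : Integrable f P)
    (hfQ : Integrable (fun x => Real.exp (f x)) Q) :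
    ∫ x, f x ∂P ≤ (klDiv P Q).toReal + ∫ x, (Real.exp (f x) - 1) ∂Q := by
  obtain ⟨hac, hllr⟩ := klDiv_ne_top_iff.1 hPQ
  have h_klFun := (integrable_klFun_rnDeriv_iff hac).2 hllr
  have h_exp : Integrable (fun x => Real.exp (f x) - 1) Q := hfQ.sub (integrable_const _)
  rw [toReal_klDiv_eq_integral_klFun hac, ← integral_add h_klFun h_exp,
    ← integral_rnDeriv_smul hac]
  exact integral_mono ((integrable_rnDeriv_smul_iff hac).2 hfP) (h_klFun.add h_exp) fun x =>
    mul_le_klFun_add_exp_sub_one ENNReal.toReal_nonneg _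

lemma exp_neg_le_quadratic {x : ℝ} (hx : 0 ≤ x) : Real.exp (-x) ≤ 1 - x + x ^ 2 / 2 := by
  have h_pos : 0 < 1 - x + x ^ 2 / 2 := by nlinarith [sq_nonneg (x - 1)]
  rw [Real.exp_neg, inv_le_iff_one_le_mul₀ (Real.exp_pos x)]
  calc 1 ≤ 1 + x ^ 4 / 4 := by linarith [pow_nonneg hx 4]
    _ = (1 - x + x ^ 2 / 2) * (1 + x + x ^ 2 / 2) := by ring
    _ ≤ (1 - x + x ^ 2 / 2) * Real.exp x :=
      mul_le_mul_of_nonneg_left (Real.quadratic_le_exp_of_nonneg hx) h_pos.le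

lemma mul_integral_sub_mul_integral_le_toReal_klDiv {P Q : Measure α} [IsFiniteMeasure P]
    [IsFiniteMeasure Q] (hPQ : klDiv P Q ≠ ∞) {Z : α → ℝ} {M : ℝ} (hZ : AEMeasurable Z Q)
    (hZM : ∀ᵐ x ∂Q, Z x ∈ Set.Icc 0 M) {l : ℝ} (hl : 0 ≤ l) :
    (l - l ^ 2 * M / 2) * ∫ x, Z x ∂Q - l * ∫ x, Z x ∂P ≤ (klDiv P Q).toReal := by
  have hac : P ≪ Q := (klDiv_ne_top_iff.1 hPQ).1
  have hZQ : Integrable Z Q := .of_mem_Icc 0 M hZ hZM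
  have hZP : Integrable Z P := .of_mem_Icc 0 M (hZ.mono_ac hac) (hac.ae_le hZM)
  have h_exp : Integrable (fun x => Real.exp (-(l * Z x))) Q := by
    refine .of_mem_Icc 0 1 (by fun_prop) ?_
    filter_upwards [hZM] with x hx
    exact ⟨(Real.exp_pos _).le, Real.exp_le_one_iff.2 (by linarith [mul_nonneg hl hx.1])⟩
  have h_dual := integral_le_toReal_klDiv_add_integral_exp_sub_one hPQ
    (f := fun x => -(l * Z x)) (hZP.const_mul l).neg h_exp
  have h_quad : ∫ x, (Real.exp (-(l * Z x)) - 1) ∂Q ≤ ∫ x, -((l - l ^ 2 * M / 2) * Z x) ∂Q := by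
    refine integral_mono_ae (h_exp.sub (integrable_const _)) (hZQ.const_mul _).neg ?_
    filter_upwards [hZM] with x hx
    have h_sq : Z x ^ 2 ≤ M * Z x := by rw [sq]; exact mul_le_mul_of_nonneg_right hx.2 hx.1
    linarith [exp_neg_le_quadratic (mul_nonneg hl hx.1), mul_pow l (Z x) 2,
      mul_le_mul_of_nonneg_left h_sq (sq_nonneg l)]
  rw [integral_neg, integral_const_mul] at h_dual h_quad
  linarith

lemma sq_sub_integral_le_mul_toReal_klDiv {P Q : Measure α} [IsFiniteMeasure P]
    [IsFiniteMeasure Q] (hPQ : klDiv P Q ≠ ∞) {Z : α → ℝ} {M : ℝ} (hZ : AEMeasurable Z Q)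
    (hZM : ∀ᵐ x ∂Q, Z x ∈ Set.Icc 0 M) {q : ℝ} (hq : 0 < q) (hP : ∫ x, Z x ∂P ≤ q)
    (hQ : q ≤ ∫ x, Z x ∂Q) :
    (q - ∫ x, Z x ∂P) ^ 2 ≤ 2 * q * M * (klDiv P Q).toReal := by
  set p := ∫ x, Z x ∂P
  have hp : 0 ≤ p := integral_nonneg_of_ae <| by
    filter_upwards [(klDiv_ne_top_iff.1 hPQ).1.ae_le hZM] with x hx using hx.1
  have hM : 0 < M := by
    by_contra! hM
    have : ∫ x, Z x ∂Q ≤ 0 := integral_nonpos_of_ae <| by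
      filter_upwards [hZM] with x hx using hx.2.trans hM
    linarith
  -- The maximiser of the quadratic `l * (q - p) - l ^ 2 * M * q / 2`.
  set l := (q - p) / (M * q)
  have hMq : 0 < M * q := mul_pos hM hq
  have hl : l * (M * q) = q - p := div_mul_cancel₀ _ hMq.ne'
  have hl_nonneg : 0 ≤ l := div_nonneg (sub_nonneg.2 hP) hMq.le
  have hlM : l * M ≤ 1 := le_of_mul_le_mul_right (by linarith) hq
  have h_kl := mul_integral_sub_mul_integral_le_toReal_klDiv hPQ hZ hZM hl_nonneg
  have h_coef : 0 ≤ l - l ^ 2 * M / 2 := by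
    linarith [mul_le_mul_of_nonneg_left hlM hl_nonneg]
  calc (q - p) ^ 2 = 2 * q * M * ((l - l ^ 2 * M / 2) * q - l * p) := by
        linear_combination (-(q - p) + l * M * q) * hl
    _ ≤ 2 * q * M * (klDiv P Q).toReal := by
        gcongr
        linarith [mul_le_mul_of_nonneg_left hQ h_coef]

lemma rnDeriv_compProd_right_of_ac [MeasurableSpace.CountableOrCountablyGenerated α β]
    {μ : Measure α} [IsFiniteMeasure μ] {κ η : Kernel α β} [IsFiniteKernel κ] [IsFiniteKernel η]
    (hκη : ∀ᵐ x ∂μ, κ x ≪ η x) :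
    (μ ⊗ₘ κ).rnDeriv (μ ⊗ₘ η) =ᵐ[μ ⊗ₘ η] fun p => κ.rnDeriv η p.1 p.2 := by
  have h_meas : Measurable fun p : α × β => κ.rnDeriv η p.1 p.2 := Kernel.measurable_rnDeriv κ η
  have h_density : μ ⊗ₘ κ = (μ ⊗ₘ η).withDensity fun p => κ.rnDeriv η p.1 p.2 := by
    rw [← Measure.compProd_withDensity h_meas]
    refine Measure.compProd_congr ?_
    filter_upwards [hκη] with x hx using (Kernel.withDensity_rnDeriv_eq hx).symm
  rw [h_density]
  exact Measure.rnDeriv_withDensity _ h_meas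

lemma lintegral_klDiv_eq_top_of_not_ac [MeasurableSpace.CountableOrCountablyGenerated α β]
    {μ : Measure α} {κ η : Kernel α β} [IsFiniteKernel κ] [IsFiniteKernel η]
    (hκη : ¬ ∀ᵐ x ∂μ, κ x ≪ η x) : ∫⁻ x, klDiv (κ x) (η x) ∂μ = ∞ := by
  have h_meas : MeasurableSet {x | ¬ κ x ≪ η x} :=
    (Kernel.measurableSet_absolutelyContinuous κ η).compl
  refine top_unique ?_
  calc ∞ = ∫⁻ x, {x | ¬ κ x ≪ η x}.indicator (fun _ => ∞) x ∂μ := by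
        rw [lintegral_indicator_const h_meas, ENNReal.top_mul (mt ae_iff.2 hκη)]
    _ ≤ ∫⁻ x, klDiv (κ x) (η x) ∂μ := lintegral_mono <|
        Set.indicator_le fun x hx => (klDiv_of_not_ac hx).ge

theorem klDiv_compProd_right [MeasurableSpace.CountableOrCountablyGenerated α β] (μ : Measure α)
    [IsFiniteMeasure μ] (κ η : Kernel α β) [IsFiniteKernel κ] [IsFiniteKernel η] :
    klDiv (μ ⊗ₘ κ) (μ ⊗ₘ η) = ∫⁻ x, klDiv (κ x) (η x) ∂μ := by
  by_cases hκη : ∀ᵐ x ∂μ, κ x ≪ η x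
  · calc klDiv (μ ⊗ₘ κ) (μ ⊗ₘ η)
        = ∫⁻ p, ENNReal.ofReal (klFun (κ.rnDeriv η p.1 p.2).toReal) ∂(μ ⊗ₘ η) := by
          rw [klDiv_eq_lintegral_klFun_of_ac
            (Measure.absolutelyContinuous_compProd_right_iff.2 hκη)]
          exact lintegral_congr_ae ((rnDeriv_compProd_right_of_ac hκη).fun_comp
            fun r => ENNReal.ofReal (klFun r.toReal))
      _ = ∫⁻ x, ∫⁻ y, ENNReal.ofReal (klFun (κ.rnDeriv η x y).toReal) ∂(η x) ∂μ :=
          Measure.lintegral_compProd (by fun_prop)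
      _ = ∫⁻ x, klDiv (κ x) (η x) ∂μ := by
          refine lintegral_congr_ae ?_
          filter_upwards [hκη] with x hx
          rw [klDiv_eq_lintegral_klFun_of_ac hx]
          exact lintegral_congr_ae ((Kernel.rnDeriv_eq_rnDeriv_measure (κ := κ) (η := η)).fun_comp
            fun r => ENNReal.ofReal (klFun r.toReal))
  · rw [lintegral_klDiv_eq_top_of_not_ac hκη,
      klDiv_of_not_ac (mt Measure.absolutelyContinuous_compProd_right_iff.1 hκη)]

lemma klDiv_map_measurableEquiv (e : α ≃ᵐ β) (P Q : Measure α) [IsFiniteMeasure P]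
    [IsFiniteMeasure Q] : klDiv (P.map e) (Q.map e) = klDiv P Q := by
  refine le_antisymm (klDiv_map_le P Q e.measurable) ?_
  simpa using klDiv_map_le (P.map e) (Q.map e) e.symm.measurable

lemma klDiv_prod_right (μ ν : Measure α) [IsFiniteMeasure μ] [IsFiniteMeasure ν] (ρ : Measure β)
    [IsProbabilityMeasure ρ] : klDiv (μ.prod ρ) (ν.prod ρ) = klDiv μ ν := by
  rw [← Measure.compProd_const, ← Measure.compProd_const, klDiv_compProd_left]

lemma klDiv_prod_left (ρ : Measure α) [IsProbabilityMeasure ρ] (μ ν : Measure β)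
    [IsFiniteMeasure μ] [IsFiniteMeasure ν] : klDiv (ρ.prod μ) (ρ.prod ν) = klDiv μ ν := by
  rw [← Measure.prod_swap (μ := μ), ← Measure.prod_swap (μ := ν)]
  exact (klDiv_map_measurableEquiv .prodComm _ _).trans (klDiv_prod_right μ ν ρ)

end KL

variable {K : ℕ}

/-! ### Divergence of one round -/

lemma obsLaw_true (ν : Instance K) (a : Fin K) : obsLaw ν (a, true) = (ν a : Measure ℝ) := by
  simp [obsLaw]

lemma obsLaw_false (ν : Instance K) (a : Fin K) : obsLaw ν (a, false) = Measure.dirac 0 := by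
  simp [obsLaw]

lemma klDiv_roundKernel (ν ν' : Instance K) (aq : Fin K × Bool) :
    klDiv (roundKernel ν aq) (roundKernel ν' aq) =
      if aq.2 then klDiv (ν aq.1 : Measure ℝ) (ν' aq.1) else 0 := by
  have h_obs : klDiv (roundKernel ν aq) (roundKernel ν' aq) =
      klDiv (obsLaw ν aq) (obsLaw ν' aq) :=
    (klDiv_prod_right _ _ _).trans (klDiv_prod_left _ _ _)
  obtain ⟨b, _ | _⟩ := aq
  · rw [h_obs, obsLaw_false, obsLaw_false, klDiv_self, if_neg Bool.false_ne_true]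
  · rw [h_obs, obsLaw_true, obsLaw_true, if_pos rfl]

lemma lintegral_roundKernel (ν : Instance K) (aq : Fin K × Bool) (f : Fin K × Bool → ℝ≥0∞) :
    ∫⁻ r, f r.1.1 ∂(roundKernel ν aq) = f aq := by
  have hf : Measurable f := measurable_of_countable f
  change ∫⁻ r, f r.1.1 ∂(((Measure.dirac aq).prod (obsLaw ν aq)).prod (volume : Measure I)) = f aq
  rw [lintegral_prod _ (by fun_prop)]
  simp only [lintegral_const, measure_univ, mul_one]
  rw [lintegral_prod _ (by fun_prop)]
  simp only [lintegral_const, measure_univ, mul_one, lintegral_dirac]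

/-! ### The law of the history -/

instance instIsProbabilityMeasureLaw (π : Strategy K) (ν : Instance K) :
    IsProbabilityMeasure (law π ν) :=
  inferInstanceAs (IsProbabilityMeasure (Kernel.trajMeasure (seedLaw K) (stepKernel π ν)))

/-- The law of the history `I_t`. -/
noncomputable def historyLaw (π : Strategy K) (ν : Instance K) (t : ℕ) : Measure (History K t) :=
  (law π ν).map (Preorder.frestrictLe t)

instance instIsProbabilityMeasureHistoryLaw (π : Strategy K) (ν : Instance K) (t : ℕ) :
    IsProbabilityMeasure (historyLaw π ν t) :=
  Measure.isProbabilityMeasure_map (by fun_prop)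

/-- The decomposition of `I_{t+1}` into `I_t` and the record of round `t + 1`. -/
def historySuccEquiv (K t : ℕ) : History K (t + 1) ≃ᵐ History K t × Entry K (t + 1) :=
  (MeasurableEquiv.IicProdIoc t.le_succ).symm.trans
    ((MeasurableEquiv.refl _).prodCongr (MeasurableEquiv.piSingleton t).symm)

lemma historyLaw_zero (π : Strategy K) (ν : Instance K) :
    historyLaw π ν 0 = (seedLaw K).map (MeasurableEquiv.piUnique _).symm := by
  rw [historyLaw, law, Kernel.trajMeasure, Measure.map_comp _ _ (by fun_prop),
    Kernel.traj_map_frestrictLe, Kernel.partialTraj_self, Measure.id_comp]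

lemma historyLaw_compProd_stepKernel (π : Strategy K) (ν : Instance K) (t : ℕ) :
    historyLaw π ν t ⊗ₘ stepKernel π ν t =
      (law π ν).map (fun ω => (Preorder.frestrictLe t ω, ω (t + 1))) :=
  Kernel.map_frestrictLe_trajMeasure_compProd_eq_map_trajMeasure

lemma historyLaw_succ_map (π : Strategy K) (ν : Instance K) (t : ℕ) :
    (historyLaw π ν (t + 1)).map (historySuccEquiv K t) =
      historyLaw π ν t ⊗ₘ stepKernel π ν t := by
  rw [historyLaw_compProd_stepKernel, historyLaw, Measure.map_map (by fun_prop) (by fun_prop)]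
  rfl

lemma klDiv_historyLaw_succ (π : Strategy K) (ν ν' : Instance K) (t : ℕ) :
    klDiv (historyLaw π ν (t + 1)) (historyLaw π ν' (t + 1)) =
      klDiv (historyLaw π ν t) (historyLaw π ν' t) +
        ∫⁻ h, klDiv (roundKernel ν (π.next t h)) (roundKernel ν' (π.next t h))
          ∂(historyLaw π ν t) := by
  rw [← klDiv_map_measurableEquiv (historySuccEquiv K t), historyLaw_succ_map,
    historyLaw_succ_map, klDiv_compProd_eq_add]
  exact congrArg _ (klDiv_compProd_right _ ((roundKernel ν).comap _ _) ((roundKernel ν').comap _ _))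

/-! ### Plays and queries -/

lemma measurable_arm (t : ℕ) : Measurable (arm t : Interaction K → Fin K) :=
  (measurable_fst.comp (measurable_fst.comp measurable_fst)).comp
    (measurable_pi_apply (X := Entry K) (t + 1))

lemma measurable_query (t : ℕ) : Measurable (query t : Interaction K → Bool) :=
  (measurable_snd.comp (measurable_fst.comp measurable_fst)).comp
    (measurable_pi_apply (X := Entry K) (t + 1))

lemma lintegral_arm_query (π : Strategy K) (ν : Instance K) (t : ℕ) (f : Fin K × Bool → ℝ≥0∞) :
    ∫⁻ ω, f (arm t ω, query t ω) ∂(law π ν) = ∫⁻ h, f (π.next t h) ∂(historyLaw π ν t) := by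
  have hf : Measurable fun p : History K t × Entry K (t + 1) => f (p.2 : Round K).1.1 :=
    (measurable_of_countable f).comp (measurable_fst.comp (measurable_fst.comp measurable_snd))
  calc ∫⁻ ω, f (arm t ω, query t ω) ∂(law π ν)
      = ∫⁻ p, f (p.2 : Round K).1.1 ∂(historyLaw π ν t ⊗ₘ stepKernel π ν t) := by
        rw [historyLaw_compProd_stepKernel, lintegral_map hf (by fun_prop)]
        rfl
    _ = ∫⁻ h, ∫⁻ r, f r.1.1 ∂(roundKernel ν (π.next t h)) ∂(historyLaw π ν t) :=
        Measure.lintegral_compProd hf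
    _ = ∫⁻ h, f (π.next t h) ∂(historyLaw π ν t) :=
        lintegral_congr fun h => lintegral_roundKernel ν (π.next t h) f

lemma measurableSet_query (t : ℕ) (a : Fin K) :
    MeasurableSet {ω : Interaction K | arm t ω = a ∧ query t ω = true} :=
  (measurable_arm t (measurableSet_singleton a)).inter
    (measurable_query t (measurableSet_singleton true))

lemma measurable_plays (T : ℕ) (a : Fin K) : Measurable (plays T a) :=
  Finset.measurable_fun_sum _ fun t _ =>
    Measurable.ite (measurable_arm t (measurableSet_singleton a)) measurable_const measurable_const

lemma measurable_queries (T : ℕ) (a : Fin K) : Measurable (queries T a) :=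
  Finset.measurable_fun_sum _ fun t _ =>
    Measurable.ite (measurableSet_query t a) measurable_const measurable_const

lemma plays_mem_Icc (T : ℕ) (a : Fin K) (ω : Interaction K) : plays T a ω ∈ Set.Icc 0 (T : ℝ) := by
  rw [plays, sum_boole]
  exact ⟨Nat.cast_nonneg _, by exact_mod_cast (card_filter_le _ _).trans_eq (card_range T)⟩

lemma queries_nonneg (T : ℕ) (a : Fin K) (ω : Interaction K) : 0 ≤ queries T a ω :=
  sum_nonneg fun _ _ => by split_ifs <;> norm_num

lemma queries_le_plays (T : ℕ) (a : Fin K) (ω : Interaction K) : queries T a ω ≤ plays T a ω :=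
  sum_le_sum fun _ _ => by split_ifs <;> simp_all

lemma integrable_plays (π : Strategy K) (ν : Instance K) (T : ℕ) (a : Fin K) :
    Integrable (plays T a) (law π ν) :=
  .of_mem_Icc 0 T (measurable_plays T a).aemeasurable (.of_forall (plays_mem_Icc T a))

lemma integrable_queries (π : Strategy K) (ν : Instance K) (T : ℕ) (a : Fin K) :
    Integrable (queries T a) (law π ν) :=
  .of_mem_Icc 0 T (measurable_queries T a).aemeasurable <| .of_forall fun ω =>
    ⟨queries_nonneg T a ω, (queries_le_plays T a ω).trans (plays_mem_Icc T a ω).2⟩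

lemma expPlays_nonneg (π : Strategy K) (ν : Instance K) (T : ℕ) (a : Fin K) :
    0 ≤ expPlays π ν T a :=
  integral_nonneg fun ω => (plays_mem_Icc T a ω).1

lemma expQueries_nonneg (π : Strategy K) (ν : Instance K) (T : ℕ) (a : Fin K) :
    0 ≤ expQueries π ν T a :=
  integral_nonneg (queries_nonneg T a)

lemma expQueries_le_expPlays (π : Strategy K) (ν : Instance K) (T : ℕ) (a : Fin K) :
    expQueries π ν T a ≤ expPlays π ν T a :=
  integral_mono (integrable_queries π ν T a) (integrable_plays π ν T a) (queries_le_plays T a)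

lemma expQueries_zero (π : Strategy K) (ν : Instance K) (a : Fin K) : expQueries π ν 0 a = 0 := by
  simp [expQueries, queries]

lemma expQueries_succ (π : Strategy K) (ν : Instance K) (T : ℕ) (a : Fin K) :
    expQueries π ν (T + 1) a =
      expQueries π ν T a + (law π ν).real {ω | arm T ω = a ∧ query T ω = true} := by
  have h_meas := measurableSet_query T a
  rw [← integral_indicator_one h_meas, expQueries, expQueries]
  refine .trans ?_
    (integral_add (integrable_queries π ν T a) ((integrable_const 1).indicator h_meas))
  refine integral_congr_ae (.of_forall fun ω => ?_)
  simp only [queries, sum_range_succ, Set.indicator_apply, Set.mem_ofPred_eq, Pi.one_apply]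

lemma lintegral_klDiv_roundKernel (π : Strategy K) (ν ν' : Instance K) (t : ℕ) :
    ∫⁻ h, klDiv (roundKernel ν (π.next t h)) (roundKernel ν' (π.next t h)) ∂(historyLaw π ν t) =
      ∑ b, klDiv (ν b : Measure ℝ) (ν' b) * law π ν {ω | arm t ω = b ∧ query t ω = true} := by
  have h_sum (ω : Interaction K) :
      klDiv (roundKernel ν (arm t ω, query t ω)) (roundKernel ν' (arm t ω, query t ω)) =
        ∑ b, klDiv (ν b : Measure ℝ) (ν' b) *
          {ω | arm t ω = b ∧ query t ω = true}.indicator 1 ω := by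
    rw [klDiv_roundKernel]
    cases h : query t ω <;> simp [Set.indicator_apply, h]
  have h_meas (b : Fin K) :
      Measurable ({ω | arm t ω = b ∧ query t ω = true}.indicator (1 : Interaction K → ℝ≥0∞)) :=
    measurable_one.indicator (measurableSet_query t b)
  rw [← lintegral_arm_query π ν t fun aq => klDiv (roundKernel ν aq) (roundKernel ν' aq),
    lintegral_congr h_sum, lintegral_finsetSum _ fun b _ => (h_meas b).const_mul _]
  refine sum_congr rfl fun b _ => ?_
  rw [lintegral_const_mul _ (h_meas b), lintegral_indicator_one (measurableSet_query t b)]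

theorem klDiv_historyLaw (π : Strategy K) (ν ν' : Instance K) (T : ℕ) :
    klDiv (historyLaw π ν T) (historyLaw π ν' T) =
      ∑ b, klDiv (ν b : Measure ℝ) (ν' b) * ENNReal.ofReal (expQueries π ν T b) := by
  induction T with
  | zero =>
    rw [historyLaw_zero π ν', ← historyLaw_zero π ν, klDiv_self]
    simp only [expQueries_zero, ENNReal.ofReal_zero, mul_zero, sum_const_zero]
  | succ t ih =>
    rw [klDiv_historyLaw_succ, ih, lintegral_klDiv_roundKernel, ← sum_add_distrib]
    refine sum_congr rfl fun b _ => ?_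
    rw [expQueries_succ, ENNReal.ofReal_add (expQueries_nonneg π ν t b) measureReal_nonneg,
      ofReal_measureReal, mul_add]

lemma klDiv_historyLaw_update (π : Strategy K) (ν : Instance K) (a : Fin K)
    (ρ : ProbabilityMeasure ℝ) (T : ℕ) :
    klDiv (historyLaw π ν T) (historyLaw π (Function.update ν a ρ) T) =
      klDiv (ν a : Measure ℝ) ρ * ENNReal.ofReal (expQueries π ν T a) := by
  rw [klDiv_historyLaw, sum_eq_single_of_mem a (mem_univ a), Function.update_self]
  intro b _ hb
  rw [Function.update_of_ne hb, klDiv_self, zero_mul]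

/-- The number of plays of `a` in rounds `1, …, T`, read off the history `I_T`: Pinsker's inequality
is applied to it under the laws of the history for two instances. -/
def historyPlays (T : ℕ) (a : Fin K) (h : History K T) : ℝ :=
  ∑ s : Fin T, if (h ⟨s + 1, mem_Iic.2 s.2⟩ : Round K).1.1.1 = a then 1 else 0

lemma historyPlays_frestrictLe (T : ℕ) (a : Fin K) (ω : Interaction K) :
    historyPlays T a (Preorder.frestrictLe T ω) = plays T a ω :=
  Fin.sum_univ_eq_sum_range (fun s => if arm s ω = a then (1 : ℝ) else 0) T

lemma measurable_historyPlays (T : ℕ) (a : Fin K) : Measurable (historyPlays T a) := by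
  refine Finset.measurable_fun_sum _ fun s _ => .ite ?_ measurable_const measurable_const
  exact ((measurable_fst.comp (measurable_fst.comp measurable_fst)).comp
    (measurable_pi_apply (⟨s + 1, mem_Iic.2 s.2⟩ : Iic T))) (measurableSet_singleton a)

lemma integral_historyPlays (π : Strategy K) (ν : Instance K) (T : ℕ) (a : Fin K) :
    ∫ h, historyPlays T a h ∂(historyLaw π ν T) = expPlays π ν T a := by
  rw [historyLaw, integral_map (by fun_prop) (measurable_historyPlays T a).aestronglyMeasurable]
  simp only [historyPlays_frestrictLe, expPlays]

lemma ae_historyPlays_mem_Icc (π : Strategy K) (ν : Instance K) (T : ℕ) (a : Fin K) :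
    ∀ᵐ h ∂(historyLaw π ν T), historyPlays T a h ∈ Set.Icc 0 (T : ℝ) := by
  refine (ae_map_iff (by fun_prop) (measurable_historyPlays T a measurableSet_Icc)).2 ?_
  exact .of_forall fun ω => historyPlays_frestrictLe T a ω ▸ plays_mem_Icc T a ω

/-! ### The lower bound -/

lemma sq_sub_expPlays_le_mul_toReal_klDiv (π : Strategy K) {ν ν' : Instance K} {a : Fin K} {T : ℕ}
    {q : ℝ} (hq : 0 < q) (hfin : klDiv (historyLaw π ν T) (historyLaw π ν' T) ≠ ∞)
    (hle : expPlays π ν T a ≤ q) (hge : q ≤ expPlays π ν' T a) :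
    (q - expPlays π ν T a) ^ 2 ≤
      2 * q * T * (klDiv (historyLaw π ν T) (historyLaw π ν' T)).toReal := by
  rw [← integral_historyPlays] at hle hge ⊢
  exact sq_sub_integral_le_mul_toReal_klDiv hfin (measurable_historyPlays T a).aemeasurable
    (ae_historyPlays_mem_Icc π ν' T a) hq hle hge

lemma mean_le_optReward (ν : Instance K) (a : Fin K) : mean (ν a) ≤ optReward ν :=
  le_ciSup (f := fun b => mean (ν b)) (Set.finite_range _).bddAbove a

lemma optArms_eq_singleton {ν : Instance K} {a : Fin K} (h : ∀ b ≠ a, mean (ν b) < mean (ν a)) :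
    optArms ν = {a} := by
  have : Nonempty (Fin K) := ⟨a⟩
  have h_le (b : Fin K) : mean (ν b) ≤ mean (ν a) := by
    rcases eq_or_ne b a with rfl | hb
    exacts [le_rfl, (h b hb).le]
  have h_opt : optReward ν = mean (ν a) := le_antisymm (ciSup_le h_le) (mean_le_optReward ν a)
  ext b
  rw [optArms, h_opt, mem_filter_univ, mem_singleton]
  exact ⟨fun hb => by_contra fun hne => (h b hne).ne hb, fun hb => hb ▸ rfl⟩

lemma optArms_update {ν : Instance K} (a : Fin K) {ρ : ProbabilityMeasure ℝ}
    (hρ : optReward ν < mean ρ) : optArms (Function.update ν a ρ) = {a} :=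
  optArms_eq_singleton fun b hb => by
    rw [Function.update_of_ne hb, Function.update_self]
    exact (mean_le_optReward ν b).trans_lt hρ

lemma BetterThanUniform.div_le_expPlays_update {D : Set (ProbabilityMeasure ℝ)} {π : Strategy K}
    (hπ : BetterThanUniform π D) {ν : Instance K} (hν : ∀ k, ν k ∈ D) (a : Fin K) {T : ℕ}
    (hT : 1 ≤ T) {ρ : ProbabilityMeasure ℝ} (hρD : ρ ∈ D) (hρ : optReward ν < mean ρ) :
    (T : ℝ) / K ≤ expPlays π (Function.update ν a ρ) T a := by
  have hD (k : Fin K) : Function.update ν a ρ k ∈ D := by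
    rcases eq_or_ne k a with rfl | hk
    · rwa [Function.update_self]
    · rw [Function.update_of_ne hk]; exact hν k
  have h := hπ _ hD T hT
  rwa [optArms_update a hρ, sum_singleton, card_singleton, Nat.cast_one, one_div_mul_eq_div] at h

lemma le_mul_toReal_KinfPlus {ν : ProbabilityMeasure ℝ} {μ : ℝ}
    {D : Set (ProbabilityMeasure ℝ)} (hfin : KinfPlus ν μ D ≠ ∞) {A c : ℝ} (hc : 0 ≤ c)
    (h : ∀ ρ ∈ D, μ < mean ρ → klDiv (ν : Measure ℝ) ρ ≠ ∞ →
      A ≤ c * (klDiv (ν : Measure ℝ) ρ).toReal) :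
    A ≤ c * (KinfPlus ν μ D).toReal := by
  have h_lim : Filter.Tendsto (fun r => c * r) (𝓝[>] (KinfPlus ν μ D).toReal)
      (𝓝 (c * (KinfPlus ν μ D).toReal)) :=
    ((continuous_const_mul c).tendsto _).mono_left nhdsWithin_le_nhds
  refine ge_of_tendsto h_lim (eventually_nhdsWithin_of_forall fun r hr => ?_)
  have h_lt : KinfPlus ν μ D < ENNReal.ofReal r := (ENNReal.lt_ofReal_iff_toReal_lt hfin).2 hr
  simp only [KinfPlus, iInf_lt_iff] at h_lt
  obtain ⟨ρ, ⟨hρD, hρ⟩, h_kl⟩ := h_lt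
  have h_kl_le := ((ENNReal.lt_ofReal_iff_toReal_lt h_kl.ne_top).1 h_kl).le
  exact (h ρ hρD hρ h_kl.ne_top).trans (mul_le_mul_of_nonneg_left h_kl_le hc)

lemma BetterThanUniform.sq_sub_expPlays_le {D : Set (ProbabilityMeasure ℝ)} {π : Strategy K}
    (hπ : BetterThanUniform π D) {ν : Instance K} (hν : ∀ k, ν k ∈ D) (a : Fin K) {T : ℕ}
    (hT : 1 ≤ T) (hle : expPlays π ν T a ≤ (T : ℝ) / K)
    (hfin : KinfPlus (ν a) (optReward ν) D ≠ ∞) :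
    ((T : ℝ) / K - expPlays π ν T a) ^ 2 ≤ ((T : ℝ) / K) ^ 2 *
      (2 * (K * expQueries π ν T a) * (KinfPlus (ν a) (optReward ν) D).toReal) := by
  have hK : (0 : ℝ) < K := by exact_mod_cast a.pos
  have hT' : (0 : ℝ) < T := by exact_mod_cast hT
  rw [← mul_assoc]
  have h_queries := expQueries_nonneg π ν T a
  refine le_mul_toReal_KinfPlus hfin (by positivity) fun ρ hρD hρ hkl => ?_
  have h_hist : klDiv (historyLaw π ν T) (historyLaw π (Function.update ν a ρ) T) ≠ ∞ := by
    rw [klDiv_historyLaw_update]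
    exact ENNReal.mul_ne_top hkl ENNReal.ofReal_ne_top
  have h_sq := sq_sub_expPlays_le_mul_toReal_klDiv π (div_pos hT' hK) h_hist hle
    (hπ.div_le_expPlays_update hν a hT hρD hρ)
  rw [klDiv_historyLaw_update, ENNReal.toReal_mul,
    ENNReal.toReal_ofReal h_queries] at h_sq
  exact h_sq.trans_eq (by field_simp)

lemma BetterThanUniform.mul_one_sub_sqrt_le_expPlays {D : Set (ProbabilityMeasure ℝ)}
    {π : Strategy K} (hπ : BetterThanUniform π D) {ν : Instance K} (hν : ∀ k, ν k ∈ D) (a : Fin K)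
    {T : ℕ} (hT : 1 ≤ T) (hfin : KinfPlus (ν a) (optReward ν) D ≠ ∞) :
    (T : ℝ) / K * (1 - √(2 * min (K * expQueries π ν T a) (T : ℝ) *
      (KinfPlus (ν a) (optReward ν) D).toReal)) ≤ expPlays π ν T a := by
  have hK : (0 : ℝ) < K := by exact_mod_cast a.pos
  have hTK : (0 : ℝ) ≤ T / K := by positivity
  rcases le_total (expPlays π ν T a) ((T : ℝ) / K) with hle | hge
  · have h_min : K * expQueries π ν T a ≤ T :=
      (le_div_iff₀' hK).1 ((expQueries_le_expPlays π ν T a).trans hle)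
    have h_sqrt := Real.le_sqrt_of_sq_le (hπ.sq_sub_expPlays_le hν a hT hle hfin)
    rw [Real.sqrt_mul (sq_nonneg _), Real.sqrt_sq hTK] at h_sqrt
    rw [min_eq_left h_min]
    linarith
  · exact (mul_le_of_le_one_right hTK (sub_le_self 1 (Real.sqrt_nonneg _))).trans hge

lemma sqrt_two_mul_mul_le_half {n : ℝ} {k : ℝ≥0∞}
    (h : ENNReal.ofReal n ≤ 1 / (8 * K * k)) : √(2 * (K * n) * k.toReal) ≤ 1 / 2 := by
  have h_mul := ENNReal.toReal_mono ENNReal.one_ne_top (ENNReal.mul_le_of_le_div h)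
  simp only [ENNReal.toReal_mul, ENNReal.toReal_ofReal', ENNReal.toReal_natCast,
    ENNReal.toReal_ofNat, ENNReal.toReal_one] at h_mul
  have : n * (8 * K * k.toReal) ≤ 1 :=
    (mul_le_mul_of_nonneg_right (le_max_left n 0) (by positivity)).trans h_mul
  exact Real.sqrt_le_iff.2 ⟨by norm_num, by linarith⟩

end QueryBandit

theorem proposition1_general {K : ℕ} (D : Set (ProbabilityMeasure ℝ))
    (hD : ∀ ν ∈ D, Integrable (fun x : ℝ => x) (ν : Measure ℝ))
    (π : QueryBandit.Strategy K) (hπ : QueryBandit.BetterThanUniform π D)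
    (ν : QueryBandit.Instance K) (hν : ∀ k, ν k ∈ D)
    (a : Fin K) (T : ℕ) (hT : 1 ≤ T) :
    QueryBandit.expPlays π ν T a ≥
        (if QueryBandit.KinfPlus (ν a) (QueryBandit.optReward ν) D = ∞ then 0
          else (T : ℝ) / K * (1 - √(2 * min (K * QueryBandit.expQueries π ν T a) (T : ℝ) *
            (QueryBandit.KinfPlus (ν a) (QueryBandit.optReward ν) D).toReal))) ∧
      (QueryBandit.KinfPlus (ν a) (QueryBandit.optReward ν) D < ∞ →
        ENNReal.ofReal (QueryBandit.expQueries π ν T a) ≤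
          1 / (8 * K * QueryBandit.KinfPlus (ν a) (QueryBandit.optReward ν) D) →
        QueryBandit.expPlays π ν T a ≥ (T : ℝ) / (2 * K)) := by
  have hTK : (0 : ℝ) ≤ T / K := by positivity
  refine ⟨?_, fun hfin h_queries => ?_⟩
  · split_ifs with hfin
    · exact QueryBandit.expPlays_nonneg π ν T a
    · exact hπ.mul_one_sub_sqrt_le_expPlays hν a hT hfin
  · have h_sqrt : √(2 * min (K * QueryBandit.expQueries π ν T a) (T : ℝ) *
        (QueryBandit.KinfPlus (ν a) (QueryBandit.optReward ν) D).toReal) ≤ 1 / 2 :=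
      (Real.sqrt_le_sqrt (by gcongr; exact min_le_left _ _)).trans
        (QueryBandit.sqrt_two_mul_mul_le_half h_queries)
    calc (T : ℝ) / (2 * K) = T / K * (1 - 1 / 2) := by ring
      _ ≤ _ := mul_le_mul_of_nonneg_left (sub_le_sub_left h_sqrt 1) hTK
      _ ≤ _ := hπ.mul_one_sub_sqrt_le_expPlays hν a hT hfin.ne

theorem proposition1 {K : ℕ} (D : Set (ProbabilityMeasure ℝ))
    (hD : ∀ ν ∈ D, Integrable (fun x : ℝ => x) (ν : Measure ℝ))
    (π : QueryBandit.Strategy K) (hπ : QueryBandit.BetterThanUniform π D)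
    (ν : QueryBandit.Instance K) (hν : ∀ k, ν k ∈ D)
    (a : Fin K) (ha : a ∉ QueryBandit.optArms ν) (T : ℕ) (hT : 1 ≤ T) :
    QueryBandit.expPlays π ν T a ≥
        (if QueryBandit.KinfPlus (ν a) (QueryBandit.optReward ν) D = ∞ then 0
          else (T : ℝ) / K * (1 - √(2 * min (K * QueryBandit.expQueries π ν T a) (T : ℝ) *
            (QueryBandit.KinfPlus (ν a) (QueryBandit.optReward ν) D).toReal))) ∧
      (QueryBandit.KinfPlus (ν a) (QueryBandit.optReward ν) D < ∞ →
        ENNReal.ofReal (QueryBandit.expQueries π ν T a) ≤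
          1 / (8 * K * QueryBandit.KinfPlus (ν a) (QueryBandit.optReward ν) D) →
        QueryBandit.expPlays π ν T a ≥ (T : ℝ) / (2 * K)) :=
  proposition1_general D hD π hπ ν hν a T hT
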